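/- **Conventions.** Automata are deterministic and finite; the transition function may be partial. For a positive integer $k$, a language $L$ over an alphabet $\Sigma$ is *$k$-testable* if any two nonempty words $u,v\in\Sigma^+$ with the same prefix of length $k-1$, the same suffix of length $k-1$ (a word shorter than $k-1$ is its own prefix and suffix) and the same set of factors of length $k$ are either both in $L$ or both outside $L$. An automaton is *locally testable* if the language it accepts is $k$-testable for some $k$; the least such $k$ is its *order of local testability*. It is *reduced* if every state is reachable from the start state and distinct states accept different languages. For a state transition graph $\Gamma$, write $p\succ q$ if $p\ne q$ and $q$ is reachable from $p$. The *2-tuple graph* $\Gamma\Gamma$ has as nodes the pairs $(p,q)$ with $p\succ q$, and an edge from the node $(p,q)$ to the node $(r,t)$ if $p\sigma=r$ and $q\sigma=t$ for some letter $\sigma$. A path on $\Gamma\Gamma$ is *SCC-restricted* if all components of its nodes lie in one strongly connected component of $\Gamma$; its length is its number of edges. **The automata.** For $n\ge 1$ let $\mathbf M_n$ be the state transition graph over $\{a,b\}$ with the following states: $p_0,\dots,p_{2n+1}$; $t_0,\dots,t_{n+2}$; $q_0,\dots,q_{n+1}$; $d_0,\dots,d_{n-1}$; and $u$. Its transitions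 are $$p_ia=p_{i+1}\ (0\le i\le 2n),\qquad t_ja=t_{j+1}\ (0\le j\le n+1),\qquad q_ja=q_{j+1}\ (0\le j\le n),$$ $$p_{n+1+i}\,b=d_i,\quad d_i\,b=q_{n-1-i}\ (0\le i<n),\qquad p_{2n+1}b=u,\quad u\,b=t_0,$$ $$t_jb=p_{n+3-j}\ (3\le j\le n+2),\qquad q_{n+1}b=p_0,$$ and all other transitions are undefined. **Theorem.** 1. For every $n\ge1$, $\mathbf M_n$ has $5n+8$ states and is strongly connected, and its 2-tuple graph has an SCC-restricted path of length $2n^2+4n-6$. For every choice of a start state and of a nonempty set of accepting states, the resulting automaton is reduced and locally testable, and its order of local testability is at least $2n^2+4n-4$. 2. The order of local testability of these automata is of the order of magnitude $n^2$: there are constants $c>0$ and $C$ such that for all $n\ge1$, all start states and all nonempty sets of accepting states it lies between $cn^2$ and $Cn^2$. 3. Consequently the conjecture of Kim, McNaughton and McCloskey that the order is $O(N^{1.5})$ for alphabet size two is false: there are no constants $C$ and $N_0$ such that every reduced locally testable deterministic automaton with $N\ge N_0$ states over a two-letter alphabet has order of local testability at most $C\,N^{1.5}$. This remains so if only automata with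 a total transition function are considered. -/

import Mathlib

namespace LocTest

/-- The state transition graph of a deterministic finite automaton whose transition function may
be partial: `step q x = none` means that `q x` is undefined. -/
structure StateGraph (α Q : Type) where
  step : Q → α → Option Q

namespace StateGraph

variable {α Q : Type} (Γ : StateGraph α Q)

/-- `Γ.run q w` is the node `q w`, or `none` if it does not exist. -/
def run (q : Q) (w : List α) : Option Q := w.foldlM Γ.step q

/-- The node `q` is reachable from the node `p`. -/
def Reach (p q : Q) : Prop := ∃ w : List α, Γ.run p w = some q

/-- `p ≻ q`: the node `q` is reachable from the node `p`, and the two nodes are distinct. -/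
def Succ (p q : Q) : Prop := Γ.Reach p q ∧ p ≠ q

/-- `p ∼ q`: the nodes `p` and `q` belong to one strongly connected component. -/
def SameSCC (p q : Q) : Prop := Γ.Reach p q ∧ Γ.Reach q p

def StronglyConnected : Prop := ∀ p q : Q, Γ.SameSCC p q

/-- The graph is complete: every transition is defined. -/
def Complete : Prop := ∀ (p : Q) (x : α), (Γ.step p x).isSome

/-- The nodes of the 2-tuple graph: the pairs `(p, q)` with `p ≻ q`. -/
def PairNode (v : Q × Q) : Prop := Γ.Succ v.1 v.2

/-- The edges of the 2-tuple graph: `(p, q) → (r, t)` if one letter `x` gives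
`p x = r` and `q x = t`. -/
def PairEdge (v w : Q × Q) : Prop :=
  Γ.PairNode v ∧ Γ.PairNode w ∧ ∃ x : α, Γ.step v.1 x = some w.1 ∧ Γ.step v.2 x = some w.2

/-- `v 0, …, v l` is a path of length `l` (that is, with `l` edges) on the 2-tuple graph. -/
def IsPairPath (l : ℕ) (v : Fin (l + 1) → Q × Q) : Prop :=
  (∀ i, Γ.PairNode (v i)) ∧ ∀ i : Fin l, Γ.PairEdge (v i.castSucc) (v i.succ)

/-- A path on the 2-tuple graph is SCC-restricted if all components of its nodes belong to one
strongly connected component of the state transition graph. -/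
def IsSCCRestrictedPath (l : ℕ) (v : Fin (l + 1) → Q × Q) : Prop :=
  Γ.IsPairPath l v ∧ ∃ s : Q, ∀ i, Γ.SameSCC s (v i).1 ∧ Γ.SameSCC s (v i).2

end StateGraph

/-- A deterministic automaton with a possibly partial transition function. -/
structure PartialDFA (α Q : Type) extends StateGraph α Q where
  start : Q
  accept : Set Q

/-- The set of factors of `w` of length `k`. -/
def factors {α : Type} (k : ℕ) (w : List α) : Set (List α) := {x | x <:+: w ∧ x.length = k}

/-- `L` is `k`-testable, `k` a positive integer: membership of a nonempty word in `L` depends only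
on its prefix and its suffix of length `k - 1` (the whole word if it is shorter) and on the set of
its factors of length `k`. -/
def KTestable {α : Type} (k : ℕ) (L : Language α) : Prop :=
  1 ≤ k ∧ ∀ u v : List α, u ≠ [] → v ≠ [] →
    u.take (k - 1) = v.take (k - 1) → u.rtake (k - 1) = v.rtake (k - 1) →
    factors k u = factors k v → (u ∈ L ↔ v ∈ L)

namespace PartialDFA

variable {α Q : Type} (A : PartialDFA α Q)

/-- The language of words that lead from the state `q` to an accepting state. -/
def acceptsFrom (q : Q) : Language α := {w | ∃ f ∈ A.accept, A.run q w = some f}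

/-- The language accepted by the automaton. -/
def accepts : Language α := A.acceptsFrom A.start

/-- Every state is reachable from the start, and distinct states are inequivalent. -/
def Reduced : Prop :=
  (∀ q, A.Reach A.start q) ∧ ∀ p q, A.acceptsFrom p = A.acceptsFrom q → p = q

def LocallyTestable : Prop := ∃ k, KTestable k A.accepts

/-- The order of local testability: the least `k` such that the automaton is `k`-testable
(meaningful only for locally testable automata). -/
noncomputable def order : ℕ := sInf {k | KTestable k A.accepts}

end PartialDFA

/-- The alphabet of size two. -/
inductive Letter : Type
  | a
  | b

/-- The states of the automaton with parameter `n`, with distinguished states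
`p = mid 0`, `q = bot 0` and, for `n ≥ 1`, `r = top 3`. -/
inductive State (n : ℕ) : Type
  /-- `mid i` is `p aⁱ`, on the middle line. -/
  | mid (i : Fin (2 * n + 2))
  /-- `top j` is `p a²ⁿ⁺¹ b² aʲ`, on the top line. -/
  | top (j : Fin (n + 3))
  /-- `bot j` is `q aʲ`, on the bottom line. -/
  | bot (j : Fin (n + 2))
  /-- `down i` is `p aⁿ⁺¹⁺ⁱ b`, between the middle line and the bottom line. -/
  | down (i : Fin n)
  /-- `up` is `p a²ⁿ⁺¹ b`, between the middle line and the top line. -/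
  | up

/-- The transitions of the automaton with parameter `n`. -/
def stepM (n : ℕ) : State n → Letter → Option (State n)
  | .mid i, .a => if h : i.val + 1 < 2 * n + 2 then some (.mid ⟨i.val + 1, h⟩) else none
  | .mid i, .b =>
      if i.val = 2 * n + 1 then some .up
      else if h : n + 1 ≤ i.val ∧ i.val < 2 * n + 1 then
        some (.down ⟨i.val - (n + 1), by omega⟩)
      else none
  | .down _, .a => none
  | .down i, .b => some (.bot ⟨n - 1 - i.val, by omega⟩)
  | .up, .a => none
  | .up, .b => some (.top ⟨0, by omega⟩)
  | .top j, .a => if h : j.val + 1 < n + 3 then some (.top ⟨j.val + 1, h⟩) else none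
  | .top j, .b => if h : 3 ≤ j.val then some (.mid ⟨n + 3 - j.val, by omega⟩) else none
  | .bot j, .a => if h : j.val + 1 < n + 2 then some (.bot ⟨j.val + 1, h⟩) else none
  | .bot j, .b => if j.val = n + 1 then some (.mid ⟨0, by omega⟩) else none

/-- The state transition graph of the automaton with parameter `n`. -/
def graphM (n : ℕ) : StateGraph Letter (State n) := ⟨stepM n⟩

/-- The automaton with parameter `n`, given a start state and a set of accepting states. -/
def autM (n : ℕ) (start : State n) (accept : Set (State n)) : PartialDFA Letter (State n) :=
  { graphM n with start := start, accept := accept }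

end LocTest

/-! In a strongly connected reduced automaton, a word of length `l` that leads two states to
distinct states forces the order to be at least `l + 2` (`PartialDFA.length_lt_of_kTestable`).
Conversely, if no two states are led to distinct states by a word of length at least `m`, then the
order is at most `m + 1` (`PartialDFA.kTestable_of_synchronizing`). So everything turns on the
longest words on which two states fail to merge.

In the automaton such a word proceeds in rounds, starting from `mid 0` and `mid 1`. In each round
the left state returns to `mid 0` over the bottom line, while the right state passes over the top
line and comes back one step further right. The distance thus grows by only one per round of linear
length, and `exists_long_word` gets quadratic length from `n - 1` rounds.

For the upper bound, letters act injectively, so distinct states stay distinct, and a lexicographic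
rank of pairs with quadratic range increases at every common step (`level_progress_lt`). This bound
also gives reducedness. Adding a rejecting sink makes the automaton complete without changing its
language, and quadratic growth beats the exponent 3/2. -/

namespace LocTest

/-! ### Runs, pair paths and ranks in state transition graphs. -/

namespace StateGraph

variable {α Q : Type} {Γ : StateGraph α Q}

@[simp] theorem run_nil (q : Q) : Γ.run q [] = some q := rfl

theorem run_cons (q : Q) (x : α) (w : List α) :
    Γ.run q (x :: w) = (Γ.step q x).bind fun r => Γ.run r w := rfl

theorem run_append (q : Q) (u v : List α) :
    Γ.run q (u ++ v) = (Γ.run q u).bind fun r => Γ.run r v := by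
  unfold run
  rw [List.foldlM_append]
  rfl

@[simp] theorem run_singleton (q : Q) (x : α) : Γ.run q [x] = Γ.step q x := by
  rw [run_cons]; cases Γ.step q x <;> rfl

theorem run_append_of {p q : Q} {u : List α} (h : Γ.run p u = some q) (v : List α) :
    Γ.run p (u ++ v) = Γ.run q v := by
  rw [run_append, h]; rfl

theorem run_append_eq_some {p r : Q} {u v : List α} :
    Γ.run p (u ++ v) = some r ↔ ∃ q, Γ.run p u = some q ∧ Γ.run q v = some r := by
  rw [run_append, Option.bind_eq_some_iff]

theorem Reach.trans {p q r : Q} (h : Γ.Reach p q) (h' : Γ.Reach q r) : Γ.Reach p r := by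
  obtain ⟨u, hu⟩ := h
  obtain ⟨v, hv⟩ := h'
  exact ⟨u ++ v, by rw [run_append_of hu, hv]⟩

theorem Reach.of_step {p q : Q} {x : α} (h : Γ.step p x = some q) : Γ.Reach p q :=
  ⟨[x], by rw [run_singleton, h]⟩

/-- Every letter acts as a partial injective map. -/
def Injective (Γ : StateGraph α Q) : Prop :=
  ∀ p q x r, Γ.step p x = some r → Γ.step q x = some r → p = q

theorem Injective.run (hΓ : Γ.Injective) {p q r : Q} {w : List α}
    (hp : Γ.run p w = some r) (hq : Γ.run q w = some r) : p = q := by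
  induction w generalizing p q with
  | nil => simp_all
  | cons x w ih =>
    rw [run_cons, Option.bind_eq_some_iff] at hp hq
    obtain ⟨p', hp, hp'⟩ := hp
    obtain ⟨q', hq, hq'⟩ := hq
    obtain rfl := ih hp' hq'
    exact hΓ _ _ _ _ hp hq

/-- A word that leads two nodes of a strongly connected graph to distinct nodes traces an
SCC-restricted path on the 2-tuple graph. -/
theorem StronglyConnected.exists_isSCCRestrictedPath (hΓ : Γ.StronglyConnected)
    {p q p' q' : Q} {w : List α} (hp : Γ.run p w = some p') (hq : Γ.run q w = some q')
    (hne : p' ≠ q') : ∃ v, Γ.IsSCCRestrictedPath w.length v := by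
  suffices h : ∃ v : Fin (w.length + 1) → Q × Q, v 0 = (p, q) ∧ Γ.IsPairPath w.length v by
    obtain ⟨v, -, hv⟩ := h
    exact ⟨v, hv, p, fun i => ⟨hΓ _ _, hΓ _ _⟩⟩
  induction w generalizing p q with
  | nil =>
    obtain rfl : p = p' := by simpa using hp
    obtain rfl : q = q' := by simpa using hq
    exact ⟨fun _ => (p, q), rfl, fun i => ⟨(hΓ _ _).1, hne⟩, fun i => i.elim0⟩
  | cons x w ih =>
    have hpq : p ≠ q := by
      rintro rfl
      exact hne (Option.some.inj (hp.symm.trans hq))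
    rw [run_cons, Option.bind_eq_some_iff] at hp hq
    obtain ⟨p₁, hp, hp'⟩ := hp
    obtain ⟨q₁, hq, hq'⟩ := hq
    obtain ⟨v, hv0, hv⟩ := ih hp' hq'
    refine ⟨Fin.cons (p, q) v, rfl, ?_, ?_⟩
    · intro i
      refine Fin.cases ⟨(hΓ _ _).1, hpq⟩ (fun j => ?_) i
      rw [Fin.cons_succ]
      exact hv.1 j
    · intro i
      refine Fin.cases ?_ (fun j => ?_) i
      · refine ⟨⟨(hΓ _ _).1, hpq⟩, ?_, x, ?_, ?_⟩
        · rw [Fin.cons_succ]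
          exact hv.1 _
        · rw [Fin.cons_succ]
          exact hp.trans (by rw [hv0])
        · rw [Fin.cons_succ]
          exact hq.trans (by rw [hv0])
      · rw [Fin.cons_succ, ← Fin.succ_castSucc, Fin.cons_succ]
        exact hv.2 j

/-- A rank that increases along the pairs of distinct nodes bounds the length of a word that is
defined at two nodes. -/
theorem length_add_rank_le (hΓ : Γ.Injective) (rank : Q → Q → ℕ)
    (hrank : ∀ p q x p' q', p ≠ q → Γ.step p x = some p' → Γ.step q x = some q' →
      rank p q < rank p' q')
    {p q p' q' : Q} {w : List α} (hne : p ≠ q) (hp : Γ.run p w = some p')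
    (hq : Γ.run q w = some q') : w.length + rank p q ≤ rank p' q' := by
  induction w generalizing p q with
  | nil => simp_all
  | cons x w ih =>
    rw [run_cons, Option.bind_eq_some_iff] at hp hq
    obtain ⟨p₁, hp, hp'⟩ := hp
    obtain ⟨q₁, hq, hq'⟩ := hq
    have hne' : p₁ ≠ q₁ := by
      rintro rfl
      exact hne (hΓ _ _ _ _ hp hq)
    have := hrank _ _ _ _ _ hne hp hq
    have := ih hne' hp' hq'
    simp only [List.length_cons]
    omega

theorem StronglyConnected.exists_step (hΓ : Γ.StronglyConnected) {p q : Q} (hne : p ≠ q) (r : Q) :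
    ∃ x r', Γ.step r x = some r' := by
  obtain ⟨s, hs⟩ : ∃ s, r ≠ s := by
    by_contra! h
    exact hne ((h p).symm.trans (h q))
  obtain ⟨w, hw⟩ := (hΓ r s).1
  cases w with
  | nil => exact absurd (by simpa using hw) hs
  | cons x w =>
    rw [run_cons, Option.bind_eq_some_iff] at hw
    obtain ⟨r', hr, -⟩ := hw
    exact ⟨x, r', hr⟩

theorem StronglyConnected.exists_run (hΓ : Γ.StronglyConnected) {p q : Q} (hne : p ≠ q) (r : Q)
    (m : ℕ) : ∃ w r', w.length = m ∧ Γ.run r w = some r' := by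
  induction m generalizing r with
  | zero => exact ⟨[], r, rfl, rfl⟩
  | succ m ih =>
    obtain ⟨x, s, hs⟩ := hΓ.exists_step hne r
    obtain ⟨w, r', hw, hr⟩ := ih s
    exact ⟨x :: w, r', by simp [hw], by rw [run_cons, hs]; exact hr⟩

end StateGraph

/-! ### Factors and suffixes of concatenated words. -/

theorem mem_factors_append_of_suffix {α : Type} {k : ℕ} {u v w : List α} (hw : w <:+ u)
    (hk : k ≤ w.length + 1) {x : List α} (hx : x ∈ factors k (u ++ v)) :
    x ∈ factors k u ∨ x ∈ factors k (w ++ v) := by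
  obtain ⟨⟨s, t, h⟩, hl⟩ := hx
  obtain ⟨u', rfl⟩ := hw
  rw [List.append_assoc, List.append_assoc] at h
  rcases Nat.lt_or_ge s.length u'.length with hs | hs
  · left
    refine ⟨List.IsPrefix.isInfix ?_ |>.trans (List.IsSuffix.isInfix (List.drop_suffix s.length _)), hl⟩
    have hpre : s ++ x <+: (u' ++ w) ++ v := ⟨t, by simpa using h⟩
    have hpre' : s ++ x <+: u' ++ w :=
      List.prefix_of_prefix_length_le hpre (List.prefix_append _ _) (by simp; omega)
    obtain ⟨z, hz⟩ := hpre'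
    exact ⟨z, by rw [← hz]; simp⟩
  · right
    refine ⟨?_, hl⟩
    have hpre : u' <+: s :=
      List.prefix_of_prefix_length_le ⟨w ++ v, rfl⟩ ⟨x ++ t, h⟩ hs
    obtain ⟨z, rfl⟩ := hpre
    rw [List.append_assoc, List.append_cancel_left_eq] at h
    exact ⟨z, t, by simpa using h⟩

theorem factors_mono {α : Type} {k : ℕ} {u v : List α} (h : u <:+: v) :
    factors k u ⊆ factors k v := fun _ hx => ⟨hx.1.trans h, hx.2⟩

theorem rtake_append_eq_of_suffix {α : Type} {k : ℕ} {u v w : List α} (hu : w <:+ u)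
    (hv : w <:+ v) (hk : k ≤ w.length) : u.rtake k = v.rtake k := by
  obtain ⟨u', rfl⟩ := hu
  obtain ⟨v', rfl⟩ := hv
  simp only [List.rtake_eq_reverse_take_reverse, List.reverse_append]
  rw [List.take_append_of_le_length (by simpa using hk),
    List.take_append_of_le_length (by simpa using hk)]

/-! ### Testability from below and from above, and completion by a sink. -/

namespace PartialDFA

variable {α Q : Type} {A : PartialDFA α Q}

/-- In a strongly connected reduced automaton a word of length `k` leading two states to distinct
states prevents the language from being `k + 1`-testable. -/
theorem not_kTestable_of_run (hA : A.StronglyConnected) (hred : A.Reduced)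
    {p q p' q' : Q} {w : List α} (hp : A.run p w = some p') (hq : A.run q w = some q')
    (hne : p' ≠ q') : ¬ KTestable (w.length + 1) A.accepts := by
  rintro ⟨-, hk⟩
  have hpq : p ≠ q := by
    rintro rfl
    exact hne (Option.some.inj (hp.symm.trans hq))
  obtain ⟨x, hx⟩ := hred.1 p
  obtain ⟨z, hz⟩ := (hA p' q).1
  obtain ⟨y, hy⟩ := (hA q' p).1
  -- Testability only concerns nonempty words, so `U` below must not be empty.
  have hwz : w ++ z ≠ [] := by
    intro h
    have := (StateGraph.run_append_of hp z).trans hz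
    rw [h] at this
    exact hpq (Option.some.inj this)
  -- `U` ends in state `p'`, and `U ++ (z ++ w)` ends in `q'`. The extension creates no new factor
  -- of length `w.length + 1`: `U` ends in `w`, and `w ++ z ++ w` already occurs inside `U`. Both
  -- words end in `w`, so any common continuation `t` preserves the agreement and cannot separate
  -- `p'` from `q'`.
  set U := x ++ (w ++ (z ++ (w ++ (y ++ w)))) with hU
  have hUrun : A.run A.start U = some p' := by
    rw [hU, StateGraph.run_append_of hx, StateGraph.run_append_of hp, StateGraph.run_append_of hz,
      StateGraph.run_append_of hq, StateGraph.run_append_of hy, hp]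
  have hVrun : A.run A.start (U ++ (z ++ w)) = some q' := by
    rw [StateGraph.run_append_of hUrun, StateGraph.run_append_of hz, hq]
  have hUsuf : w <:+ U := ⟨x ++ (w ++ (z ++ (w ++ y))), by simp [hU]⟩
  have hU0 : U ≠ [] := by
    intro h
    apply hwz
    simp only [hU, List.append_eq_nil_iff] at h
    simp [h]
  refine hne (hred.2 _ _ ?_)
  ext t
  have key : U ++ t ∈ A.accepts ↔ (U ++ (z ++ w)) ++ t ∈ A.accepts := by
    apply hk
    · simp [hU0]
    · simp [hU0]
    · rw [Nat.add_sub_cancel, List.append_assoc U,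
        List.take_append_of_le_length hUsuf.length_le,
        List.take_append_of_le_length hUsuf.length_le]
    · rw [Nat.add_sub_cancel]
      refine rtake_append_eq_of_suffix (w := w ++ t) ?_ ?_ (by simp)
      · obtain ⟨s, hs⟩ := hUsuf
        exact ⟨s, by rw [← hs]; simp⟩
      · exact ⟨U ++ z, by simp⟩
    · have hsub : factors (w.length + 1) (w ++ t) ⊆ factors (w.length + 1) (U ++ t) := by
        obtain ⟨s, hs⟩ := hUsuf
        exact factors_mono ⟨s, [], by rw [← hs]; simp⟩
      apply Set.Subset.antisymm
      · intro v hv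
        rcases mem_factors_append_of_suffix hUsuf le_rfl hv with h | h
        · exact factors_mono ⟨[], z ++ w ++ t, by simp⟩ h
        · exact factors_mono ⟨U ++ z, [], by simp⟩ h
      · intro v hv
        rcases mem_factors_append_of_suffix (w := w) ⟨U ++ z, by simp⟩ le_rfl hv with h | h
        · rcases mem_factors_append_of_suffix hUsuf le_rfl h with h | h
          · exact factors_mono ⟨[], t, by simp⟩ h
          · exact factors_mono ⟨x, y ++ w ++ t, by simp [hU]⟩ h
        · exact hsub h
  have h₁ : ∀ {V r}, A.run A.start V = some r → (V ++ t ∈ A.accepts ↔ t ∈ A.acceptsFrom r) := by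
    intro V r h
    change (∃ f ∈ A.accept, A.run A.start (V ++ t) = some f) ↔ ∃ f ∈ A.accept, A.run r t = some f
    rw [StateGraph.run_append_of h]
  rw [← h₁ hUrun, ← h₁ hVrun, key]

/-- States that are still distinct after `w` are distinct after each prefix of `w`, so the previous
criterion applies to the prefix of length `k - 1`. -/
theorem length_lt_of_kTestable (hA : A.StronglyConnected) (hred : A.Reduced)
    {p q p' q' : Q} {w : List α} (hp : A.run p w = some p') (hq : A.run q w = some q')
    (hne : p' ≠ q') {k : ℕ} (hk : KTestable k A.accepts) : w.length + 2 ≤ k := by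
  by_contra! hlt
  have h1 := hk.1
  rw [← List.take_append_drop (k - 1) w, StateGraph.run_append_eq_some] at hp hq
  obtain ⟨p₁, hp, hp'⟩ := hp
  obtain ⟨q₁, hq, hq'⟩ := hq
  refine not_kTestable_of_run hA hred hp hq ?_ ?_
  · rintro rfl
    exact hne (Option.some.inj (hp'.symm.trans hq'))
  · rwa [List.length_take, min_eq_left (by omega), Nat.sub_add_cancel h1]

/-- The last `m` letters read determine the current state whenever the run exists. Since transitions
may be undefined, the run on `v` must first be shown to exist; each of its steps is copied from an
occurrence of the same factor in `u`. The common suffix then gives the common final state. -/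
theorem mem_accepts_of_factors {m : ℕ}
    (hA : ∀ p q p' q' w, m ≤ w.length → A.run p w = some p' → A.run q w = some q' → p' = q')
    {u v : List α} (htake : u.take m = v.take m) (hrtake : u.rtake m = v.rtake m)
    (hfac : factors (m + 1) u = factors (m + 1) v) (hu : u ∈ A.accepts) : v ∈ A.accepts := by
  obtain ⟨f, hf, hrun⟩ := hu
  have hdef : ∀ z, z <+: u → ∃ r, A.run A.start z = some r := by
    rintro z ⟨t, rfl⟩
    obtain ⟨r, hr, -⟩ := StateGraph.run_append_eq_some.1 hrun
    exact ⟨r, hr⟩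
  have hv : ∀ z, z <+: v → ∃ r, A.run A.start z = some r := by
    intro z
    induction z using List.reverseRecOn with
    | nil => exact fun _ => ⟨_, rfl⟩
    | append_singleton z c ih =>
      intro hz
      rcases Nat.lt_or_ge z.length m with hlt | hge
      · apply hdef
        have : z ++ [c] <+: v.take m := by
          rw [List.prefix_take_iff]
          exact ⟨hz, by simpa using hlt⟩
        rw [← htake] at this
        exact this.trans (List.take_prefix _ _)
      · obtain ⟨r, hr⟩ := ih ((List.prefix_append _ _).trans hz)
        have hsuf : z.drop (z.length - m) <:+ z := List.drop_suffix _ _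
        set x := z.drop (z.length - m) with hx
        have hxl : x.length = m := by simp [hx]; omega
        obtain ⟨z', hz'⟩ := hsuf
        have hxc : x ++ [c] ∈ factors (m + 1) u := by
          rw [hfac]
          refine ⟨List.IsInfix.trans ⟨z', [], ?_⟩ hz.isInfix, by simp [hxl]⟩
          rw [← hz']
          simp
        obtain ⟨⟨s, t, hst⟩, -⟩ := hxc
        rw [← hst, StateGraph.run_append_eq_some] at hrun
        obtain ⟨r₁, hr₁, -⟩ := hrun
        rw [← List.append_assoc, StateGraph.run_append_eq_some] at hr₁
        obtain ⟨r₂, hr₂, hc⟩ := hr₁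
        obtain ⟨r₃, -, hr₃⟩ := StateGraph.run_append_eq_some.1 hr₂
        have hr' := hr
        rw [← hz'] at hr'
        obtain ⟨r₄, -, hr₄⟩ := StateGraph.run_append_eq_some.1 hr'
        -- After reading `x`, the runs on `u` and on `v` are in one state, so the letter `c` is
        -- defined there for `v` as well.
        obtain rfl := hA _ _ _ _ x hxl.ge hr₃ hr₄
        exact ⟨r₁, by rw [StateGraph.run_append_of hr, hc]⟩
  obtain ⟨g, hg⟩ := hv v (List.prefix_refl v)
  rcases Nat.lt_or_ge u.length m with hlt | hge
  · have : v = u := by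
      rw [List.take_of_length_le hlt.le] at htake
      have hl := congrArg List.length htake
      rw [List.length_take] at hl
      rw [htake, List.take_of_length_le (by omega)]
    exact ⟨f, hf, by rw [this, hrun]⟩
  · have hvl : m ≤ v.length := by
      have hl := congrArg List.length htake
      simp only [List.length_take] at hl
      omega
    have hul : (u.rtake m).length = m := by simp [List.rtake]; omega
    have hus : u.take (u.length - m) ++ u.rtake m = u := List.take_append_drop _ _
    have hvs : v.take (v.length - m) ++ u.rtake m = v := by
      rw [hrtake]; exact List.take_append_drop _ _
    have hg' := hg
    rw [← hvs] at hg'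
    rw [← hus] at hrun
    obtain ⟨r, -, hr⟩ := StateGraph.run_append_eq_some.1 hrun
    obtain ⟨s, -, hs⟩ := StateGraph.run_append_eq_some.1 hg'
    obtain rfl := hA _ _ _ _ _ hul.ge hr hs
    exact ⟨f, hf, hg⟩

/-- If every word of length at least `m` leads all states at which it is defined to one state,
then the accepted language is `m + 1`-testable. -/
theorem kTestable_of_synchronizing {m : ℕ}
    (hA : ∀ p q p' q' w, m ≤ w.length → A.run p w = some p' → A.run q w = some q' → p' = q') :
    KTestable (m + 1) A.accepts :=
  ⟨Nat.le_add_left _ _, fun _ _ _ _ h₁ h₂ h₃ =>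
    ⟨mem_accepts_of_factors hA h₁ h₂ h₃, mem_accepts_of_factors hA h₁.symm h₂.symm h₃.symm⟩⟩

/-- A strongly connected automaton in which no long word is defined at two distinct states is
reduced. -/
theorem reduced_of_stronglyConnected (hA : A.StronglyConnected) {m : ℕ}
    (hm : ∀ p q p' q' w, m ≤ w.length → A.run p w = some p' → A.run q w = some q' → p = q)
    (hF : A.accept.Nonempty) : A.Reduced := by
  refine ⟨fun q => (hA _ _).1, fun p q h => ?_⟩
  by_contra hne
  obtain ⟨f, hf⟩ := hF
  -- A word of length `m` defined at `p` is defined nowhere else; its extension to an accepting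
  -- state separates `p` from `q`.
  obtain ⟨w, r, hw, hr⟩ := hA.exists_run hne p m
  obtain ⟨y, hy⟩ := (hA r f).1
  have hmem : w ++ y ∈ A.acceptsFrom p := ⟨f, hf, by rw [StateGraph.run_append_of hr, hy]⟩
  have hmem' := hmem
  rw [h] at hmem'
  obtain ⟨g, -, hg⟩ := hmem'
  obtain ⟨s, hs, -⟩ := StateGraph.run_append_eq_some.1 hg
  exact hne (hm _ _ _ _ w hw.ge hr hs)

/-- The completion of an automaton by a rejecting sink. -/
def completion (A : PartialDFA α Q) : PartialDFA α (Option Q) where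
  step q x := some (q.bind fun r => A.step r x)
  start := some A.start
  accept := some '' A.accept

theorem completion_complete (A : PartialDFA α Q) : A.completion.Complete := fun _ _ => rfl

theorem completion_run (A : PartialDFA α Q) (q : Option Q) (w : List α) :
    A.completion.run q w = some (q.bind fun r => A.run r w) := by
  induction w generalizing q with
  | nil => cases q <;> rfl
  | cons x w ih =>
    rw [StateGraph.run_cons]
    change A.completion.run (q.bind fun r => A.step r x) w = _
    rw [ih, Option.bind_assoc]
    rfl

theorem completion_acceptsFrom_some (A : PartialDFA α Q) (q : Q) :
    A.completion.acceptsFrom (some q) = A.acceptsFrom q := by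
  ext w
  change (∃ f ∈ some '' A.accept, A.completion.run (some q) w = some f) ↔
    ∃ f ∈ A.accept, A.run q w = some f
  rw [completion_run]
  simp [eq_comm]

theorem notMem_completion_acceptsFrom_none (A : PartialDFA α Q) (w : List α) :
    w ∉ A.completion.acceptsFrom none := by
  rintro ⟨f, ⟨g, -, rfl⟩, h⟩
  rw [completion_run] at h
  simp at h

theorem completion_accepts (A : PartialDFA α Q) : A.completion.accepts = A.accepts :=
  A.completion_acceptsFrom_some A.start

theorem completion_reduced (hA : A.Reduced) (hne : ∀ q, ∃ w, w ∈ A.acceptsFrom q)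
    (hpart : ∃ q x, A.step q x = none) : A.completion.Reduced := by
  constructor
  · rintro (_ | q)
    · obtain ⟨q, x, hq⟩ := hpart
      obtain ⟨w, hw⟩ := hA.1 q
      refine ⟨w ++ [x], ?_⟩
      rw [completion_run]
      change some (A.run A.start (w ++ [x])) = _
      rw [StateGraph.run_append_of hw, StateGraph.run_singleton, hq]
    · obtain ⟨w, hw⟩ := hA.1 q
      refine ⟨w, ?_⟩
      rw [completion_run]
      exact congrArg some hw
  · rintro (_ | p) (_ | q) h
    · rfl
    · obtain ⟨w, hw⟩ := hne q
      rw [← completion_acceptsFrom_some, ← h] at hw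
      exact (A.notMem_completion_acceptsFrom_none w hw).elim
    · obtain ⟨w, hw⟩ := hne p
      rw [← completion_acceptsFrom_some, h] at hw
      exact (A.notMem_completion_acceptsFrom_none w hw).elim
    · rw [completion_acceptsFrom_some, completion_acceptsFrom_some] at h
      rw [hA.2 _ _ h]

end PartialDFA

/-! ### The quadratic upper bound: injectivity and the rank of pairs. -/

theorem nat_card_state (n : ℕ) : Finite (State n) ∧ Nat.card (State n) = 5 * n + 8 := by
  let e : State n ≃ (Fin (2 * n + 2) ⊕ Fin (n + 3)) ⊕ (Fin (n + 2) ⊕ Fin n) ⊕ Unit :=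
    { toFun := fun
        | .mid i => .inl (.inl i)
        | .top j => .inl (.inr j)
        | .bot j => .inr (.inl (.inl j))
        | .down i => .inr (.inl (.inr i))
        | .up => .inr (.inr ())
      invFun := fun
        | .inl (.inl i) => .mid i
        | .inl (.inr j) => .top j
        | .inr (.inl (.inl j)) => .bot j
        | .inr (.inl (.inr i)) => .down i
        | .inr (.inr _) => .up
      left_inv := by rintro (_ | _ | _ | _ | _) <;> rfl
      right_inv := by rintro ((_ | _) | (_ | _) | _) <;> rfl }
  refine ⟨Finite.of_equiv _ e.symm, ?_⟩
  rw [Nat.card_congr e, Nat.card_eq_fintype_card]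
  simp only [Fintype.card_sum, Fintype.card_fin, Fintype.card_unit]
  omega

theorem graphM_injective (n : ℕ) : (graphM n).Injective := by
  intro p q x r hp hq
  change stepM n p x = some r at hp
  change stepM n q x = some r at hq
  rcases p with ⟨i, hi⟩ | ⟨i, hi⟩ | ⟨i, hi⟩ | ⟨i, hi⟩ | _ <;>
  rcases q with ⟨j, hj⟩ | ⟨j, hj⟩ | ⟨j, hj⟩ | ⟨j, hj⟩ | _ <;>
  cases x <;>
  simp only [stepM] at hp hq <;>
  (try split_ifs at hp hq) <;>
  simp only [reduceCtorEq, Option.some.injEq] at hp hq <;>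
  subst hp <;>
  simp only [reduceCtorEq, State.mid.injEq, State.top.injEq, State.bot.injEq, State.down.injEq,
    Fin.mk.injEq] at hq ⊢ <;>
  omega

/-- The first component of the rank of a pair of states: on the pairs with long common words it is
the distance of the two states on the middle line, up to a shift. -/
def level (n : ℕ) : State n → State n → ℕ
  | .mid i, .mid j => (i.val - j.val) + (j.val - i.val) + n + 1
  | .top i, .top j => (i.val - j.val) + (j.val - i.val) + n + 1
  | .down i, .up => (n - i.val) + n + 1
  | .up, .down i => (n - i.val) + n + 1
  | .bot i, .top j => i.val + n + 2 - j.val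
  | .top j, .bot i => i.val + n + 2 - j.val
  -- Mixed pairs get a level above all others and never leave it; only their progress matters.
  | _, _ => 3 * n + 10

/-- The second component of the rank of a pair of states: the progress within one level. -/
def progress (n : ℕ) : State n → State n → ℕ
  | .top i, .top _ => i.val
  | .mid i, .mid _ => n + 3 + i.val
  | .down _, .up => 3 * n + 10
  | .up, .down _ => 3 * n + 10
  | .bot _, .top j => 3 * n + 11 + j.val
  | .top j, .bot _ => 3 * n + 11 + j.val
  | .down _, .down _ => 0
  | .up, .up => 0
  | .bot i, .bot _ => 1 + i.val
  -- For `i ≤ n` the two states have no common letter, so this is a dead end and may have high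
  -- progress.
  | .mid i, .down _ => if n < i.val then 0 else 3 * n + 10
  | .mid i, .up => if n < i.val then 0 else 3 * n + 10
  | .down _, .mid i => if n < i.val then 0 else 3 * n + 10
  | .up, .mid i => if n < i.val then 0 else 3 * n + 10
  | .mid i, .top _ => 2 + i.val
  | .mid i, .bot _ => 2 + i.val
  | .top _, .mid i => 2 + i.val
  | .bot _, .mid i => 2 + i.val
  | .down _, .bot _ => 1
  | .down _, .top _ => 1
  | .up, .bot _ => 1
  | .up, .top _ => 1
  | .bot _, .down _ => 1
  | .top _, .down _ => 1
  | .bot _, .up => 1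
  | .top _, .up => 1

theorem level_le (n : ℕ) (p q : State n) : level n p q ≤ 3 * n + 10 := by
  rcases p with ⟨i, hi⟩ | ⟨i, hi⟩ | ⟨i, hi⟩ | ⟨i, hi⟩ | _ <;>
  rcases q with ⟨j, hj⟩ | ⟨j, hj⟩ | ⟨j, hj⟩ | ⟨j, hj⟩ | _ <;>
  simp only [level] <;> omega

theorem progress_lt (n : ℕ) (p q : State n) : progress n p q < 4 * n + 20 := by
  rcases p with ⟨i, hi⟩ | ⟨i, hi⟩ | ⟨i, hi⟩ | ⟨i, hi⟩ | _ <;>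
  rcases q with ⟨j, hj⟩ | ⟨j, hj⟩ | ⟨j, hj⟩ | ⟨j, hj⟩ | _ <;>
  simp only [progress] <;> (try split_ifs) <;> omega

/-- The level is constant along a round and rises by one when a pair on the bottom and top lines
returns to the middle line. -/
theorem level_progress_lt {n : ℕ} {p q p' q' : State n} {x : Letter} (hne : p ≠ q)
    (hp : stepM n p x = some p') (hq : stepM n q x = some q') :
    level n p q < level n p' q' ∨
      level n p q = level n p' q' ∧ progress n p q < progress n p' q' := by
  rcases p with ⟨i, hi⟩ | ⟨i, hi⟩ | ⟨i, hi⟩ | ⟨i, hi⟩ | _ <;>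
  rcases q with ⟨j, hj⟩ | ⟨j, hj⟩ | ⟨j, hj⟩ | ⟨j, hj⟩ | _ <;>
  cases x <;>
  simp only [stepM] at hp hq <;>
  (try split_ifs at hp hq) <;>
  simp only [reduceCtorEq, Option.some.injEq] at hp hq <;>
  subst hp <;> subst hq <;>
  simp only [ne_eq, not_true_eq_false, State.mid.injEq, State.top.injEq, State.bot.injEq,
    State.down.injEq, Fin.mk.injEq] at hne <;>
  simp only [level, progress, true_and] <;> (try split_ifs) <;> omega

theorem length_lt_of_run {n : ℕ} {p q p' q' : State n} {w : List Letter} (hne : p ≠ q)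
    (hp : (graphM n).run p w = some p') (hq : (graphM n).run q w = some q') :
    w.length < (3 * n + 11) * (4 * n + 20) := by
  have h := StateGraph.length_add_rank_le (graphM_injective n)
    -- The lexicographic order is encoded in one number, as `progress` stays below `4 * n + 20`.
    (fun p q => level n p q * (4 * n + 20) + progress n p q) ?_ hne hp hq
  · have h₁ := Nat.mul_le_mul_right (4 * n + 20) (level_le n p' q')
    have h₂ := progress_lt n p' q'
    rw [show 3 * n + 11 = (3 * n + 10) + 1 from rfl, Nat.add_one_mul]
    omega
  · intro p q x p' q' hne hp hq
    have h₂ := progress_lt n p q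
    rcases level_progress_lt hne hp hq with h | ⟨h, h'⟩
    · have := Nat.mul_le_mul_right (4 * n + 20) (Nat.succ_le_of_lt h)
      rw [Nat.succ_mul] at this
      omega
    · rw [h]
      omega

/-! ### The long word and strong connectivity. -/

theorem run_mid_replicate {n i k j : ℕ} (h : i + k = j) (hj : j < 2 * n + 2) :
    (graphM n).run (.mid ⟨i, by omega⟩) (List.replicate k .a) = some (.mid ⟨j, hj⟩) := by
  induction k generalizing i with
  | zero => subst h; rfl
  | succ k ih =>
    rw [List.replicate_succ, StateGraph.run_cons]
    simp only [graphM, stepM]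
    rw [dif_pos (by omega)]
    exact ih (by omega)

theorem run_top_replicate {n i k j : ℕ} (h : i + k = j) (hj : j < n + 3) :
    (graphM n).run (.top ⟨i, by omega⟩) (List.replicate k .a) = some (.top ⟨j, hj⟩) := by
  induction k generalizing i with
  | zero => subst h; rfl
  | succ k ih =>
    rw [List.replicate_succ, StateGraph.run_cons]
    simp only [graphM, stepM]
    rw [dif_pos (by omega)]
    exact ih (by omega)

theorem run_bot_replicate {n i k j : ℕ} (h : i + k = j) (hj : j < n + 2) :
    (graphM n).run (.bot ⟨i, by omega⟩) (List.replicate k .a) = some (.bot ⟨j, hj⟩) := by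
  induction k generalizing i with
  | zero => subst h; rfl
  | succ k ih =>
    rw [List.replicate_succ, StateGraph.run_cons]
    simp only [graphM, stepM]
    rw [dif_pos (by omega)]
    exact ih (by omega)

/-- The way from the middle line over the bottom line back to the state `mid 0`. -/
theorem run_mid_bot {n x i k l : ℕ} (hi : i < n) (hx : x + k = n + 1 + i) (hl : l = i + 2) :
    (graphM n).run (.mid ⟨x, by omega⟩)
      (List.replicate k .a ++ ([.b, .b] ++ (List.replicate l .a ++ [.b]))) =
      some (.mid ⟨0, by omega⟩) := by
  rw [StateGraph.run_append_of (run_mid_replicate hx (by omega)),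
    StateGraph.run_append_of (q := .bot ⟨n - 1 - i, by omega⟩),
    StateGraph.run_append_of (run_bot_replicate (j := n + 1) (by omega) (by omega))]
  · simp [graphM, stepM]
  · simp only [StateGraph.run_cons, graphM, stepM]
    rw [if_neg (by omega), dif_pos (by omega)]
    simp

/-- The way from the middle line over the top line back to the middle line. -/
theorem run_mid_top {n x k l y : ℕ} (hx : x + k = 2 * n + 1) (hl : 3 ≤ l) (hl' : l + y = n + 3)
    (hy : 1 ≤ y) :
    (graphM n).run (.mid ⟨x, by omega⟩)
      (List.replicate k .a ++ ([.b, .b] ++ (List.replicate l .a ++ [.b]))) =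
      some (.mid ⟨y, by omega⟩) := by
  rw [StateGraph.run_append_of (run_mid_replicate hx (by omega)),
    StateGraph.run_append_of (q := .top ⟨0, by omega⟩),
    StateGraph.run_append_of (run_top_replicate (j := l) (by omega) (by omega))]
  · simp only [StateGraph.run_singleton, graphM, stepM]
    rw [dif_pos hl]
    simp only [Option.some.injEq, State.mid.injEq, Fin.mk.injEq]
    omega
  · simp [StateGraph.run_cons, graphM, stepM]

/-- The long word on which the states `mid 0` and `mid 1` do not merge. -/
theorem exists_long_word {n k : ℕ} (hk : k < n) :
    ∃ w : List Letter, w.length + k * (k + 1) = k * (3 * n + 6) ∧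
      (graphM n).run (.mid ⟨0, by omega⟩) w = some (.mid ⟨0, by omega⟩) ∧
      (graphM n).run (.mid ⟨1, by omega⟩) w = some (.mid ⟨k + 1, by omega⟩) := by
  induction k with
  | zero => exact ⟨[], by simp, rfl, rfl⟩
  | succ k ih =>
    obtain ⟨w, hw, h₀, h₁⟩ := ih (by omega)
    -- The first block of `a` takes `mid (k + 1)` to the end of the middle line and `mid 0` to the
    -- exit leading to `bot k`. The second takes `bot k` to the end of the bottom line and `top 0`
    -- to the exit leading to `mid (k + 2)`.
    refine ⟨w ++ (List.replicate (2 * n - k) .a ++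
      ([.b, .b] ++ (List.replicate (n + 1 - k) .a ++ [.b]))), ?_, ?_, ?_⟩
    · simp only [List.length_append, List.length_replicate, List.length_cons, List.length_nil]
      have h : 2 * n - k + (2 + (n + 1 - k + 1)) + 2 * (k + 1) = 3 * n + 6 := by omega
      linarith
    · rw [StateGraph.run_append_of h₀]
      exact run_mid_bot (i := n - 1 - k) (by omega) (by omega) (by omega)
    · rw [StateGraph.run_append_of h₁]
      exact run_mid_top (by omega) (by omega) (by omega) (by omega)

theorem graphM_stronglyConnected {n : ℕ} (hn : 1 ≤ n) : (graphM n).StronglyConnected := by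
  have mm : ∀ {i j : ℕ} (hij : i ≤ j) (hj : j < 2 * n + 2),
      (graphM n).Reach (.mid ⟨i, by omega⟩) (.mid ⟨j, hj⟩) := fun hij hj =>
    ⟨_, run_mid_replicate (Nat.add_sub_cancel' hij) hj⟩
  have tt : ∀ {i j : ℕ} (hij : i ≤ j) (hj : j < n + 3),
      (graphM n).Reach (.top ⟨i, by omega⟩) (.top ⟨j, hj⟩) := fun hij hj =>
    ⟨_, run_top_replicate (Nat.add_sub_cancel' hij) hj⟩
  have bb : ∀ {i j : ℕ} (hij : i ≤ j) (hj : j < n + 2),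
      (graphM n).Reach (.bot ⟨i, by omega⟩) (.bot ⟨j, hj⟩) := fun hij hj =>
    ⟨_, run_bot_replicate (Nat.add_sub_cancel' hij) hj⟩
  have md : ∀ {i : ℕ} (hi : i < n),
      (graphM n).Reach (.mid ⟨n + 1 + i, by omega⟩) (.down ⟨i, hi⟩) := fun hi =>
    .of_step (x := .b) (by
      simp only [graphM, stepM]
      rw [if_neg (by omega), dif_pos (by omega)]
      simp)
  have db : ∀ {i : ℕ} (hi : i < n),
      (graphM n).Reach (.down ⟨i, hi⟩) (.bot ⟨n - 1 - i, by omega⟩) := fun _ =>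
    .of_step (x := .b) rfl
  have bm : (graphM n).Reach (.bot ⟨n + 1, by omega⟩) (.mid ⟨0, by omega⟩) :=
    .of_step (x := .b) (by simp [graphM, stepM])
  have mu : (graphM n).Reach (.mid ⟨2 * n + 1, by omega⟩) .up :=
    .of_step (x := .b) (by simp [graphM, stepM])
  have ut : (graphM n).Reach .up (.top ⟨0, by omega⟩) := .of_step (x := .b) rfl
  have tm : (graphM n).Reach (.top ⟨n + 2, by omega⟩) (.mid ⟨1, by omega⟩) :=
    .of_step (x := .b) (by
      simp only [graphM, stepM]
      rw [dif_pos (by omega)]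
      simp only [Option.some.injEq, State.mid.injEq, Fin.mk.injEq]
      omega)
  have b0 : ∀ {j : ℕ} (hj : j < n + 2), (graphM n).Reach (.bot ⟨j, hj⟩) (.mid ⟨0, by omega⟩) :=
    fun hj => (bb (by omega) (by omega)).trans bm
  have m10 : (graphM n).Reach (.mid ⟨1, by omega⟩) (.mid ⟨0, by omega⟩) :=
    (mm (by omega) (by omega)).trans ((md (i := 0) (by omega)).trans ((db _).trans (b0 _)))
  have t0 : ∀ {j : ℕ} (hj : j < n + 3), (graphM n).Reach (.top ⟨j, hj⟩) (.mid ⟨0, by omega⟩) :=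
    fun hj => (tt (by omega) (by omega)).trans (tm.trans m10)
  have to0 : ∀ q, (graphM n).Reach q (.mid ⟨0, by omega⟩) := by
    rintro (⟨i, hi⟩ | ⟨j, hj⟩ | ⟨j, hj⟩ | ⟨i, hi⟩ | _)
    · exact (mm (by omega) (by omega)).trans (mu.trans (ut.trans (t0 _)))
    · exact t0 _
    · exact b0 _
    · exact (db _).trans (b0 _)
    · exact ut.trans (t0 _)
  have from0 : ∀ q, (graphM n).Reach (.mid ⟨0, by omega⟩) q := by
    rintro (⟨i, hi⟩ | ⟨j, hj⟩ | ⟨j, hj⟩ | ⟨i, hi⟩ | _)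
    · exact mm (by omega) _
    · exact (mm (by omega) (by omega)).trans (mu.trans (ut.trans (tt (by omega) _)))
    · exact (mm (by omega) (by omega)).trans ((md (i := n - 1) (by omega)).trans
        ((db _).trans (bb (by omega) _)))
    · exact (mm (by omega) (by omega)).trans (md _)
    · exact (mm (by omega) (by omega)).trans mu
  exact fun p q => ⟨(to0 p).trans (from0 q), (to0 q).trans (from0 p)⟩

theorem exists_separating_word {n : ℕ} (hn : 1 ≤ n) :
    ∃ (w : List Letter) (p q p' q' : State n), w.length = 2 * n ^ 2 + 4 * n - 6 ∧
      (graphM n).run p w = some p' ∧ (graphM n).run q w = some q' ∧ p' ≠ q' := by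
  obtain ⟨k, rfl⟩ := Nat.exists_eq_add_of_le' hn
  obtain ⟨w, hw, h₀, h₁⟩ := exists_long_word (Nat.lt_succ_self k)
  refine ⟨w, _, _, _, _, ?_, h₀, h₁, by simp⟩
  have : w.length + 6 = 2 * (k + 1) ^ 2 + 4 * (k + 1) := by
    rw [Nat.succ_eq_add_one] at hw
    linarith [hw, show k * (3 * (k + 1) + 6) + 6 = 2 * (k + 1) ^ 2 + 4 * (k + 1) + k * (k + 1) by ring]
  omega

/-! ### Order of the automata and refutation of the conjecture. -/

theorem autM_reduced {n : ℕ} (hn : 1 ≤ n) (s : State n) {F : Set (State n)} (hF : F.Nonempty) :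
    (autM n s F).Reduced := by
  refine PartialDFA.reduced_of_stronglyConnected (m := (3 * n + 11) * (4 * n + 20))
    (graphM_stronglyConnected hn) ?_ hF
  intro p q p' q' w hw hp hq
  by_contra hne
  exact (length_lt_of_run hne hp hq).not_ge hw

theorem autM_kTestable (n : ℕ) (s : State n) (F : Set (State n)) :
    KTestable ((3 * n + 11) * (4 * n + 20) + 1) (autM n s F).accepts := by
  refine PartialDFA.kTestable_of_synchronizing fun p q p' q' w hw hp hq => ?_
  obtain rfl : p = q := by
    by_contra hne
    exact (length_lt_of_run hne hp hq).not_ge hw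
  exact Option.some.inj (hp.symm.trans hq)

theorem le_order_autM {n : ℕ} (hn : 1 ≤ n) (s : State n) {F : Set (State n)} (hF : F.Nonempty) :
    2 * n ^ 2 + 4 * n - 4 ≤ (autM n s F).order := by
  obtain ⟨w, p, q, p', q', hw, hp, hq, hne⟩ := exists_separating_word hn
  have h := PartialDFA.length_lt_of_kTestable (A := autM n s F) (graphM_stronglyConnected hn)
    (autM_reduced hn s hF) hp hq hne (Nat.sInf_mem (s := {k | KTestable k (autM n s F).accepts})
      ⟨_, autM_kTestable n s F⟩)
  exact le_trans (by omega) h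

theorem order_autM_le (n : ℕ) (s : State n) (F : Set (State n)) :
    (autM n s F).order ≤ (3 * n + 11) * (4 * n + 20) + 1 :=
  Nat.sInf_le (autM_kTestable n s F)

theorem two_mul_sq_le_order_autM {n : ℕ} (hn : 1 ≤ n) (s : State n) {F : Set (State n)}
    (hF : F.Nonempty) : 2 * (n : ℝ) ^ 2 ≤ (autM n s F).order := by
  have h : 2 * n ^ 2 ≤ (autM n s F).order := le_trans (by omega) (le_order_autM hn s hF)
  exact_mod_cast h

/-- The completed automata refute every bound of the form `C * N ^ (3 / 2)`. -/
theorem exists_order_gt (C : ℝ) (N₀ : ℕ) :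
    ∃ (Q : Type) (_ : Fintype Q) (A : PartialDFA Letter Q), N₀ ≤ Fintype.card Q ∧ A.Complete ∧
      A.Reduced ∧ A.LocallyTestable ∧ C * (Fintype.card Q : ℝ) ^ (3 / 2 : ℝ) < (A.order : ℝ) := by
  -- The parameter `m ^ 2` avoids roots: there are `5 * m ^ 2 + 9 ≤ (4 * m) ^ 2` states, so for `C ≥
  -- 0` the conjectured bound is at most `64 * C * m ^ 3`, while the order is at least `2 * m ^ 4`.
  obtain ⟨m, hm⟩ := exists_nat_gt (max (32 * C) (max N₀ 1 : ℕ))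
  have hmC : 32 * C < m := lt_of_le_of_lt (le_max_left _ _) hm
  have hmN : max N₀ 1 < m := by exact_mod_cast lt_of_le_of_lt (le_max_right _ _) hm
  have hm1 : 1 < m := lt_of_le_of_lt (le_max_right _ _) hmN
  have hmN₀ : N₀ < m := lt_of_le_of_lt (le_max_left _ _) hmN
  have hmm : m ≤ m ^ 2 := Nat.le_self_pow two_ne_zero m
  have hn : 1 ≤ m ^ 2 := by omega
  obtain ⟨hfin, hcard⟩ := nat_card_state (m ^ 2)
  let : Fintype (State (m ^ 2)) := Fintype.ofFinite _
  have hcard' : Fintype.card (Option (State (m ^ 2))) = 5 * m ^ 2 + 9 := by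
    rw [Fintype.card_option, ← Nat.card_eq_fintype_card, hcard]
  have hF : (Set.univ : Set (State (m ^ 2))).Nonempty := ⟨.up, trivial⟩
  have hacc := PartialDFA.completion_accepts (autM (m ^ 2) .up Set.univ)
  refine ⟨Option (State (m ^ 2)), inferInstance, (autM (m ^ 2) .up Set.univ).completion, ?_,
    PartialDFA.completion_complete _, ?_, ?_, ?_⟩
  · omega
  · exact PartialDFA.completion_reduced (autM_reduced hn _ hF)
      -- All states accept, so the empty word distinguishes each from the sink; the undefined
      -- transition of `up` under `a` makes the sink reachable.
      (fun q => ⟨[], q, trivial, rfl⟩) ⟨.up, .a, rfl⟩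
  · exact ⟨_, by rw [hacc]; exact autM_kTestable _ _ _⟩
  · have horder : (autM (m ^ 2) .up Set.univ).completion.order =
        (autM (m ^ 2) .up Set.univ).order := by
      unfold PartialDFA.order
      rw [hacc]
    rw [horder, hcard']
    refine lt_of_lt_of_le ?_ (two_mul_sq_le_order_autM hn _ hF)
    have hmpos : (1 : ℝ) < m := by exact_mod_cast hm1
    have hpow : ((5 * m ^ 2 + 9 : ℕ) : ℝ) ^ (3 / 2 : ℝ) ≤ (4 * m : ℝ) ^ 3 := by
      calc ((5 * m ^ 2 + 9 : ℕ) : ℝ) ^ (3 / 2 : ℝ) ≤ ((4 * m : ℝ) ^ 2) ^ (3 / 2 : ℝ) := by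
            apply Real.rpow_le_rpow (Nat.cast_nonneg _) _ (by norm_num)
            push_cast
            nlinarith
        _ = (4 * m : ℝ) ^ 3 := by
            rw [← Real.rpow_natCast, ← Real.rpow_mul (by positivity), ← Real.rpow_natCast]
            norm_num
    have hnn : (0 : ℝ) ≤ ((5 * m ^ 2 + 9 : ℕ) : ℝ) ^ (3 / 2 : ℝ) :=
      Real.rpow_nonneg (Nat.cast_nonneg _) _
    have hm3 : (0 : ℝ) < (m : ℝ) ^ 3 := by positivity
    have hlt : 32 * C * (m : ℝ) ^ 3 < m * (m : ℝ) ^ 3 := mul_lt_mul_of_pos_right hmC hm3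
    have hrhs : 2 * (((m ^ 2 : ℕ) : ℝ)) ^ 2 = 2 * (m * (m : ℝ) ^ 3) := by push_cast; ring
    rw [hrhs]
    rcases le_total C 0 with hC | hC
    · have h₀ := mul_nonpos_of_nonpos_of_nonneg hC hnn
      have : 0 < 2 * (m * (m : ℝ) ^ 3) := by positivity
      linarith
    · have h₁ := mul_le_mul_of_nonneg_left hpow hC
      have h₂ : C * (4 * m : ℝ) ^ 3 = 2 * (32 * C * (m : ℝ) ^ 3) := by ring
      linarith

end LocTest

theorem mainTheorem4 :
    -- the automata are strongly connected, reduced and locally testable, whichever start state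
    -- and nonempty set of accepting states are chosen
    (∀ n : ℕ, 1 ≤ n →
      Finite (LocTest.State n) ∧ Nat.card (LocTest.State n) = 5 * n + 8 ∧
      (LocTest.graphM n).StronglyConnected ∧
      (∃ v, (LocTest.graphM n).IsSCCRestrictedPath (2 * n ^ 2 + 4 * n - 6) v) ∧
      ∀ (s : LocTest.State n) (F : Set (LocTest.State n)), F.Nonempty →
        (LocTest.autM n s F).Reduced ∧
        (LocTest.autM n s F).LocallyTestable ∧
        2 * n ^ 2 + 4 * n - 4 ≤ (LocTest.autM n s F).order) ∧
    -- their order of local testability is of the order of magnitude `n ^ 2`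
    (∃ c C : ℝ, 0 < c ∧ ∀ n : ℕ, 1 ≤ n →
      ∀ (s : LocTest.State n) (F : Set (LocTest.State n)), F.Nonempty →
        c * (n : ℝ) ^ 2 ≤ ((LocTest.autM n s F).order : ℝ) ∧
        ((LocTest.autM n s F).order : ℝ) ≤ C * (n : ℝ) ^ 2) ∧
    -- the conjectured bound fails for alphabets of size two, even for complete automata
    ¬ ∃ (C : ℝ) (N₀ : ℕ), ∀ (Q : Type) [Fintype Q] (A : LocTest.PartialDFA LocTest.Letter Q),
        N₀ ≤ Fintype.card Q → A.Complete → A.Reduced → A.LocallyTestable →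
        (A.order : ℝ) ≤ C * (Fintype.card Q : ℝ) ^ (3 / 2 : ℝ) := by
  -- The constant 337 is `14 * 24 + 1`, the value of the upper bound at `n = 1`.
  refine ⟨fun n hn => ?_, ⟨2, 337, two_pos, fun n hn s F hF => ⟨?_, ?_⟩⟩, ?_⟩
  · refine ⟨(LocTest.nat_card_state n).1, (LocTest.nat_card_state n).2,
      LocTest.graphM_stronglyConnected hn, ?_, fun s F hF => ⟨LocTest.autM_reduced hn s hF,
        ⟨_, LocTest.autM_kTestable n s F⟩, LocTest.le_order_autM hn s hF⟩⟩
    obtain ⟨w, p, q, p', q', hw, hp, hq, hne⟩ := LocTest.exists_separating_word hn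
    rw [← hw]
    exact (LocTest.graphM_stronglyConnected hn).exists_isSCCRestrictedPath hp hq hne
  · exact LocTest.two_mul_sq_le_order_autM hn s hF
  · have h : (LocTest.autM n s F).order ≤ 337 * n ^ 2 :=
      (LocTest.order_autM_le n s F).trans (by nlinarith)
    exact_mod_cast h
  · rintro ⟨C, N₀, h⟩
    obtain ⟨Q, hQ, A, h₁, h₂, h₃, h₄, h₅⟩ := LocTest.exists_order_gt C N₀
    exact (h Q A h₁ h₂ h₃ h₄).not_gt h₅
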